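/- Let $S$ be a finite nonempty set, $n=|S|$, and let $p:2^S\to\mathbb Z\cup\{-\infty\}$ be an integer-valued (fully) supermodular set function, i.e. $p(X)+p(Y)\le p(X\cap Y)+p(X\cup Y)$ for all $X,Y\subseteq S$ with $p(X),p(Y)>-\infty$, with $p(\emptyset)=0$ and $p(S)$ finite. Let $$B=\{x\in\mathbb R^S:\ \textstyle\sum_{s\in S}x(s)=p(S),\ \sum_{s\in Z}x(s)\ge p(Z)\ \text{for every } Z\subset S\}$$ be the (integral) base-polyhedron defined by $p$; the set $B\cap\mathbb Z^S$ of its integral points is called an M-convex set. For $\pi\in\mathbb Z^S$ let $\hat p(\pi)$ denote the linear (Lovász) extension of $p$, $$\hat p(\pi)=p(I_n)\,\pi(s_n)+\sum_{j=1}^{n-1}p(I_j)\,[\pi(s_j)-\pi(s_{j+1})],$$ where the elements of $S$ are indexed so that $\pi(s_1)\ge\dots\ge\pi(s_n)$, $I_j=\{s_1,\dots,s_j\}$, and $(-\infty)\cdot 0=0$. For each $s\in S$ let $\varphi_s:\mathbb Z\to\mathbb Z\cup\{+\infty\}$ be discrete convex, i.e. $\operatorname{dom}\varphi_s=\{k\in\mathbb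 Z:\varphi_s(k)<+\infty\}$ is an interval of integers (possibly unbounded) and $\varphi_s(k-1)+\varphi_s(k+1)\ge 2\varphi_s(k)$ for all $k\in\operatorname{dom}\varphi_s$. Let $\psi_s(\ell)=\sup\{k\ell-\varphi_s(k):k\in\mathbb Z\}$ $(\ell\in\mathbb Z)$ be its integer conjugate. (If $\varphi_s\equiv+\infty$, then $\psi_s\equiv-\infty$; a sum containing $-\infty$ is $-\infty$.) Assume that (i) there exists $x\in B\cap\mathbb Z^S$ such that $\varphi_s(x(s))<+\infty$ for all $s\in S$ (primal feasibility), or (ii) there exists $\pi\in\mathbb Z^S$ such that $\hat p(\pi)>-\infty$ and $\psi_s(\pi(s))<+\infty$ for all $s\in S$ (dual feasibility). Then, in $\mathbb Z\cup\{-\infty,+\infty\}$, $$\min\Bigl\{\sum_{s\in S}\varphi_s(x(s)):x\in B\cap\mathbb Z^S\Bigr\}=\max\Bigl\{\hat p(\pi)-\sum_{s\in S}\psi_s(\pi(s)):\pi\in\mathbb Z^S\Bigr\},$$ where $\min$ and $\max$ are understood as infimum and supremum, both sides being allowed to be $-\infty$ or $+\infty$; if the common value is finite, it is an integer, and both the minimum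 and the maximum are attained. -/

import Mathlib

namespace SepConvex

/-- Inclusion of `ℤ ∪ {+∞}` into the extended reals. -/
noncomputable def topToEReal : WithTop ℤ → EReal
  | none => ⊤
  | some n => ((n : ℝ) : EReal)

/-- Inclusion of `ℤ ∪ {-∞}` into the extended reals. -/
noncomputable def botToEReal : WithBot ℤ → EReal
  | none => ⊥
  | some n => ((n : ℝ) : EReal)

/-- `φ : ℤ → ℤ ∪ {+∞}` is discrete convex: the effective domain is an interval of integers and
`φ (k - 1) + φ (k + 1) ≥ 2 φ k` for every `k` in it. -/
structure DiscreteConvex (φ : ℤ → WithTop ℤ) : Prop where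
  ordConnected_dom : {k : ℤ | φ k ≠ ⊤}.OrdConnected
  two_nsmul_le : ∀ k : ℤ, φ k ≠ ⊤ → 2 • φ k ≤ φ (k - 1) + φ (k + 1)

/-- The integer conjugate `ψ ℓ = sup {k ℓ - φ k : k ∈ ℤ}`. -/
noncomputable def intConj (φ : ℤ → WithTop ℤ) (l : ℤ) : EReal :=
  ⨆ k : ℤ, (((k * l : ℤ) : ℝ) : EReal) - topToEReal (φ k)

variable {S : Type*}

/-- The integral members of a subset of `ℝ^S`. -/
def integerPoints (B : Set (S → ℝ)) : Set (S → ℤ) :=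
  {x | (fun s => (x s : ℝ)) ∈ B}

variable [Fintype S]

/-- An enumeration of `S` along which `π` is non-increasing. -/
noncomputable def sortedEnum (π : S → ℤ) : Fin (Fintype.card S) ≃ S :=
  (Tuple.sort fun i => -π ((Fintype.equivFin S).symm i)).trans (Fintype.equivFin S).symm

theorem antitone_sortedEnum (π : S → ℤ) : Antitone (π ∘ sortedEnum π) := by
  intro i j hij
  have := Tuple.monotone_sort (fun i => -π ((Fintype.equivFin S).symm i)) hij
  simpa [sortedEnum] using this

/-- An integer-valued (fully) supermodular set function `p`, with `p X = -∞` allowed,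
`p ∅ = 0` and `p S` finite. -/
structure IsSupermodular [DecidableEq S] (p : Finset S → WithBot ℤ) : Prop where
  empty : p ∅ = 0
  univ_ne_bot : p Finset.univ ≠ ⊥
  supermodular : ∀ X Y : Finset S, p X ≠ ⊥ → p Y ≠ ⊥ → p X + p Y ≤ p (X ∩ Y) + p (X ∪ Y)

/-- The base-polyhedron `{x ∈ ℝ^S : x̃ S = p S, x̃ Z ≥ p Z for every Z ⊂ S}`,
where `x̃ Z = ∑ s ∈ Z, x s`. -/
def basePolyhedron (p : Finset S → WithBot ℤ) : Set (S → ℝ) :=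
  {x | (p Finset.univ).map (fun n : ℤ => (n : ℝ)) = ((∑ s, x s : ℝ) : WithBot ℝ) ∧
    ∀ Z : Finset S, Z ⊂ Finset.univ →
      (p Z).map (fun n : ℤ => (n : ℝ)) ≤ ((∑ s ∈ Z, x s : ℝ) : WithBot ℝ)}

/-- For an enumeration `s₁, …, sₙ` of `S`, the value
`p(Iₙ) π(sₙ) + ∑_{j < n} p(I_j) (π(s_j) - π(s_{j+1}))` with `I_j = {s₁, …, s_j}`
and the convention `(-∞) · 0 = 0`. -/
def lovaszAlong (p : Finset S → WithBot ℤ) (π : S → ℤ) (e : Fin (Fintype.card S) ≃ S) :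
    WithBot ℤ :=
  ∑ j : Fin (Fintype.card S), p (Finset.univ.filter fun s => e.symm s ≤ j) *
    ((if h : (j : ℕ) + 1 < Fintype.card S then π (e j) - π (e ⟨j + 1, h⟩) else π (e j) : ℤ) :
      WithBot ℤ)

/-- The linear (Lovász) extension of `p` at an integer vector. -/
noncomputable def lovaszExt (p : Finset S → WithBot ℤ) (π : S → ℤ) : WithBot ℤ :=
  lovaszAlong p π (sortedEnum π)

/-- The linear extension does not depend on the non-increasing enumeration. -/
theorem lovaszExt_eq (p : Finset S → WithBot ℤ) (π : S → ℤ) (e : Fin (Fintype.card S) ≃ S)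
    (he : Antitone (π ∘ e)) : lovaszExt p π = lovaszAlong p π e := by
  have key : ∀ e₁ e₂ : Fin (Fintype.card S) ≃ S, Antitone (π ∘ e₁) → Antitone (π ∘ e₂) →
      lovaszAlong p π e₁ = lovaszAlong p π e₂ := by
    intro e₁ e₂ h₁ h₂
    have hπ : ∀ j, π (e₁ j) = π (e₂ j) := by
      have := Tuple.unique_antitone (f := π ∘ e₁) (σ := Equiv.refl _) (τ := e₂.trans e₁.symm)
        (by simpa using h₁)
        (by
          have : (π ∘ e₁) ∘ (e₂.trans e₁.symm) = π ∘ e₂ := by ext j; simp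
          rw [this]; exact h₂)
      intro j
      simpa using congrFun this j
    have lev : ∀ f : Fin (Fintype.card S) ≃ S, Antitone (π ∘ f) →
        ∀ (j : Fin (Fintype.card S)) (h : (j : ℕ) + 1 < Fintype.card S),
        π (f j) ≠ π (f ⟨j + 1, h⟩) → ∀ s, f.symm s ≤ j ↔ π (f j) ≤ π s := by
      intro f hf j h hne s
      constructor
      · intro hs
        simpa using hf hs
      · intro hs
        by_contra hlt
        have h1 : (⟨j + 1, h⟩ : Fin (Fintype.card S)) ≤ f.symm s := by
          rw [Fin.le_def]
          have := Fin.lt_def.1 (not_le.1 hlt)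
          simpa using this
        have h2 := hf h1
        have h3 : π (f ⟨j + 1, h⟩) ≤ π (f j) := hf (by rw [Fin.le_def]; simp)
        simp only [Function.comp_apply, Equiv.apply_symm_apply] at h2
        omega
    unfold lovaszAlong
    refine Finset.sum_congr rfl fun j _ => ?_
    by_cases h : (j : ℕ) + 1 < Fintype.card S
    · simp only [h, dif_pos, ← hπ]
      by_cases hne : π (e₁ j) = π (e₁ ⟨j + 1, h⟩)
      · simp [hne]
      · congr 2
        ext s
        simp only [Finset.mem_filter, Finset.mem_univ, true_and]
        rw [lev e₁ h₁ j h hne s, lev e₂ h₂ j h (by rwa [← hπ, ← hπ]) s, hπ]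
    · simp only [h, dif_neg, not_false_eq_true, hπ]
      have hall : ∀ i : Fin (Fintype.card S), i ≤ j := by
        intro i
        rw [Fin.le_def]
        have := i.isLt
        omega
      simp [hall]
  exact key _ _ (antitone_sortedEnum π) he

end SepConvex

/-! Weak duality is Abel summation (`lovaszExt_le`) plus the Fenchel–Young inequality in each
coordinate.

For the converse, suppose the primal is feasible and bounded below; integrality of values gives a
minimizer `x`. Relate `t` to `s` when every tight set containing `t` contains `s`. Then moving a
unit from `t` to `s` stays in the base polyhedron (`IsIntBase.exchange`), so minimality says that
the left slope of `φ t` at `x t` is at most the right slope of `φ s` at `x s`. The relation is a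
preorder, so some integral `π` lies between the two slopes in each coordinate and is monotone along
it (`exists_monotone_between`). Its upper level sets are closed under the relation, hence tight by
supermodularity (`isTight_of_closed`), which makes the linear extension at `π` equal to the scalar
product of `π` and `x`. Local slopes being global subgradients, `π` attains the primal value.

If the primal is infeasible, the same result for the distances to the domains yields an integral
separating direction (`exists_separating`); moving a feasible dual vector along it drives the dual
value to infinity. -/

namespace SepConvex

/-! ### Integral bases and the lattice of tight sets. -/

section Integral

variable {S : Type*} [Fintype S] {p : Finset S → WithBot ℤ}

/-- Integral members of the base-polyhedron, described over the integers. -/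
structure IsIntBase (p : Finset S → WithBot ℤ) (x : S → ℤ) : Prop where
  univ_eq : p Finset.univ = ((∑ s, x s : ℤ) : WithBot ℤ)
  le_sum : ∀ Z : Finset S, p Z ≤ ((∑ s ∈ Z, x s : ℤ) : WithBot ℤ)

theorem map_cast_le_iff (a : WithBot ℤ) (b : ℤ) :
    a.map (fun n : ℤ => (n : ℝ)) ≤ ((b : ℝ) : WithBot ℝ) ↔ a ≤ (b : WithBot ℤ) := by
  cases a with
  | bot => simp
  | coe a => simp

theorem map_cast_eq_iff (a : WithBot ℤ) (b : ℤ) :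
    a.map (fun n : ℤ => (n : ℝ)) = ((b : ℝ) : WithBot ℝ) ↔ a = (b : WithBot ℤ) := by
  cases a with
  | bot => simp
  | coe a => simp

theorem mem_integerPoints_iff (x : S → ℤ) :
    x ∈ integerPoints (basePolyhedron p) ↔ IsIntBase p x := by
  have h1 : ∀ Z : Finset S, (∑ s ∈ Z, (x s : ℝ)) = ((∑ s ∈ Z, x s : ℤ) : ℝ) := fun Z => by
    push_cast; rfl
  simp only [integerPoints, basePolyhedron, Set.mem_ofPred_eq, h1, map_cast_le_iff,
    map_cast_eq_iff]
  constructor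
  · rintro ⟨h, hZ⟩
    refine ⟨h, fun Z => ?_⟩
    rcases (Finset.subset_univ Z).eq_or_ssubset with rfl | hs
    · exact h.le
    · exact hZ Z hs
  · rintro ⟨h, hZ⟩
    exact ⟨h, fun Z _ => hZ Z⟩

variable [DecidableEq S]

/-- A set `Z` is tight for `x` if `x̃ Z = p Z`. -/
def IsTight (p : Finset S → WithBot ℤ) (x : S → ℤ) (Z : Finset S) : Prop :=
  p Z = ((∑ s ∈ Z, x s : ℤ) : WithBot ℤ)

/-- Sums of `x` are modular, so supermodularity leaves no slack in the bounds for the intersection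
and the union. -/
theorem IsTight.inter_union (hp : IsSupermodular p) {x : S → ℤ}
    (hx : ∀ Z : Finset S, p Z ≤ ((∑ s ∈ Z, x s : ℤ) : WithBot ℤ)) {X Y : Finset S}
    (hX : IsTight p x X) (hY : IsTight p x Y) :
    IsTight p x (X ∩ Y) ∧ IsTight p x (X ∪ Y) := by
  unfold IsTight at *
  have h := hp.supermodular X Y (hX ▸ WithBot.coe_ne_bot) (hY ▸ WithBot.coe_ne_bot)
  have hI := hx (X ∩ Y)
  have hU := hx (X ∪ Y)
  have hs : ∑ s ∈ X ∪ Y, x s + ∑ s ∈ X ∩ Y, x s = ∑ s ∈ X, x s + ∑ s ∈ Y, x s :=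
    Finset.sum_union_inter
  rw [hX, hY, ← WithBot.coe_add] at h
  generalize p (X ∩ Y) = a at *
  generalize p (X ∪ Y) = b at *
  cases a with
  | bot => simp only [WithBot.bot_add, le_bot_iff, WithBot.coe_ne_bot] at h
  | coe a =>
    cases b with
    | bot => simp only [WithBot.add_bot, le_bot_iff, WithBot.coe_ne_bot] at h
    | coe b =>
      simp only [← WithBot.coe_add, WithBot.coe_le_coe, WithBot.coe_inj] at *
      omega

theorem isTight_empty (hp : IsSupermodular p) (x : S → ℤ) : IsTight p x ∅ := by
  simp [IsTight, hp.empty]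

/-- If every two related elements are ordered by membership in `U`, the set `U` is tight. -/
theorem isTight_of_closed (hp : IsSupermodular p) {x : S → ℤ} (hx : IsIntBase p x)
    (U : Finset S) (hU : ∀ t ∈ U, ∀ s, (∀ Z, IsTight p x Z → t ∈ Z → s ∈ Z) → s ∈ U) :
    IsTight p x U := by
  classical
  -- `D t` is the smallest tight set containing `t`; a closed `U` is the union of the `D t` with `t
  -- ∈ U`.
  let D : S → Finset S := fun t =>
    (Finset.univ.filter fun Z : Finset S => IsTight p x Z ∧ t ∈ Z).inf id
  have hD : ∀ t, IsTight p x (D t) := fun t =>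
    Finset.inf_induction (p := IsTight p x) hx.univ_eq
      (fun a ha b hb => (IsTight.inter_union hp hx.le_sum ha hb).1)
      (fun Z hZ => (Finset.mem_filter.1 hZ).2.1)
  have hmem : ∀ t s, s ∈ D t ↔ ∀ Z, IsTight p x Z → t ∈ Z → s ∈ Z := by
    intro t s
    simp [D, Finset.mem_inf]
  have hUD : U = U.sup D := by
    ext s
    simp only [Finset.mem_sup, hmem]
    exact ⟨fun hs => ⟨s, hs, fun Z _ h => h⟩, fun ⟨t, ht, h⟩ => hU t ht s h⟩
  rw [hUD]
  exact Finset.sup_induction (p := IsTight p x) (isTight_empty hp x)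
    (fun a ha b hb => (IsTight.inter_union hp hx.le_sum ha hb).2) (fun t _ => hD t)

theorem exists_isIntBase (hp : IsSupermodular p) : ∃ x, IsIntBase p x := by
  classical
  obtain ⟨c, hc⟩ := WithBot.ne_bot_iff_exists.1 hp.univ_ne_bot
  let F : Set (S → ℤ) := {x | ∀ Z : Finset S, p Z ≤ ((∑ s ∈ Z, x s : ℤ) : WithBot ℤ)}
  have hF : F.Nonempty := by
    -- A large constant vector satisfies all lower bounds; a base is then obtained by minimizing the
    -- total.
    have hM : ∃ M : ℤ, 0 ≤ M ∧ ∀ Z : Finset S, p Z ≤ (M : WithBot ℤ) := by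
      refine ⟨∑ Z : Finset S, |(p Z).unbotD 0|, Finset.sum_nonneg fun _ _ => abs_nonneg _,
        fun Z => ?_⟩
      have h := Finset.single_le_sum (f := fun Z : Finset S => |(p Z).unbotD 0|)
        (fun _ _ => abs_nonneg _) (Finset.mem_univ Z)
      cases hZ : p Z with
      | bot => simp
      | coe a =>
        rw [WithBot.coe_le_coe]
        simp only [hZ, WithBot.unbotD_coe] at h
        exact (le_abs_self a).trans h
    obtain ⟨M, hM0, hM⟩ := hM
    refine ⟨fun _ => M, fun Z => ?_⟩
    rcases Z.eq_empty_or_nonempty with rfl | hZ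
    · simp [hp.empty]
    · refine (hM Z).trans (WithBot.coe_le_coe.2 ?_)
      have : (1 : ℤ) ≤ Z.card := by exact_mod_cast hZ.card_pos
      simp only [Finset.sum_const, nsmul_eq_mul]
      nlinarith
  obtain ⟨m, ⟨x, hxF, rfl⟩, hmin⟩ := Int.exists_least_of_bdd
    (P := fun z => ∃ x ∈ F, ∑ s, x s = z)
    ⟨c, by
      rintro _ ⟨x, hx, rfl⟩
      have := hx Finset.univ
      rwa [← hc, WithBot.coe_le_coe] at this⟩
    (let ⟨x, hx⟩ := hF; ⟨_, x, hx, rfl⟩)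
  refine ⟨x, ?_, hxF⟩
  -- Otherwise `x t` could be lowered by one. Tight sets covering `S` make `S` itself tight.
  have hcover : ∀ t : S, ∃ Z, IsTight p x Z ∧ t ∈ Z := by
    intro t
    by_contra! hno
    have hsum : ∀ Z : Finset S, ∑ s ∈ Z, (x - Pi.single t 1 : S → ℤ) s =
        ∑ s ∈ Z, x s - if t ∈ Z then 1 else 0 := by
      intro Z
      simp [Finset.sum_sub_distrib, Finset.sum_pi_single']
    have hF' : x - Pi.single t 1 ∈ F := by
      intro Z
      rw [hsum]
      have h1 := hxF Z
      split_ifs with htZ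
      · have h2 : p Z ≠ _ := fun h => hno Z h htZ
        cases hZ : p Z with
        | bot => simp
        | coe a =>
          rw [hZ] at h1 h2
          simp only [WithBot.coe_le_coe, ne_eq, WithBot.coe_inj] at *
          omega
      · simpa using h1
    have := hmin _ ⟨_, hF', rfl⟩
    rw [hsum] at this
    simp at this
  choose T hT using hcover
  have huniv : (Finset.univ : Finset S) = Finset.univ.sup T := by
    ext s
    simp only [Finset.mem_univ, Finset.mem_sup, true_and, true_iff]
    exact ⟨s, (hT s).2⟩
  have : IsTight p x (Finset.univ.sup T) :=
    Finset.sup_induction (p := IsTight p x) (isTight_empty hp x)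
      (fun a ha b hb => (IsTight.inter_union hp hxF ha hb).2) (fun t _ => (hT t).1)
  rwa [← huniv] at this

/-- Only sets containing `t` but not `s` lose a unit; none of them is tight, and by integrality
their slack is at least one. -/
theorem IsIntBase.exchange {x : S → ℤ} (hx : IsIntBase p x) {s t : S}
    (h : ∀ Z, IsTight p x Z → t ∈ Z → s ∈ Z) :
    IsIntBase p (x + Pi.single s 1 - Pi.single t 1) := by
  have hsum : ∀ Z : Finset S, ∑ r ∈ Z, (x + Pi.single s 1 - Pi.single t 1 : S → ℤ) r =
      ∑ r ∈ Z, x r + (if s ∈ Z then 1 else 0) - if t ∈ Z then 1 else 0 := by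
    intro Z
    simp [Finset.sum_sub_distrib, Finset.sum_add_distrib, Finset.sum_pi_single']
  refine ⟨by rw [hsum, hx.univ_eq]; simp, fun Z => ?_⟩
  rw [hsum]
  have h1 := hx.le_sum Z
  have h2 := h Z
  unfold IsTight at h2
  cases hZ : p Z with
  | bot => simp
  | coe a =>
    rw [hZ] at h1 h2
    simp only [WithBot.coe_le_coe, WithBot.coe_inj] at *
    by_cases hs : s ∈ Z <;> by_cases ht : t ∈ Z <;> simp only [hs, ht, if_true, if_false]
    all_goals first | omega | skip
    have : a ≠ ∑ r ∈ Z, x r := fun h => hs (h2 h ht)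
    omega

end Integral

/-! ### The linear extension compared with scalar products. -/

section Lovasz

variable {S : Type*} [Fintype S] {p : Finset S → WithBot ℤ}

/-- The coefficient of `p(I_j)` in the linear extension. -/
def gap (π : S → ℤ) (e : Fin (Fintype.card S) ≃ S) (j : Fin (Fintype.card S)) : ℤ :=
  if h : (j : ℕ) + 1 < Fintype.card S then π (e j) - π (e ⟨j + 1, h⟩) else π (e j)

theorem sum_gap_Ici (π : S → ℤ) (e : Fin (Fintype.card S) ≃ S) (i : Fin (Fintype.card S)) :
    ∑ j, (if i ≤ j then gap π e j else 0) = π (e i) := by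
  -- Extending by zero past the last index turns every gap, including the last, into a difference
  -- that telescopes.
  let g : ℕ → ℤ := fun k => if h : k < Fintype.card S then π (e ⟨k, h⟩) else 0
  have hg : ∀ j : Fin (Fintype.card S), gap π e j = g j - g (j + 1) := by
    intro j
    by_cases h : (j : ℕ) + 1 < Fintype.card S <;> simp [gap, g, h]
  have h1 : ∀ j : Fin (Fintype.card S), (if i ≤ j then gap π e j else 0) =
      (fun k : ℕ => if (i : ℕ) ≤ k then g k - g (k + 1) else 0) j := by
    intro j
    simp only [hg, Fin.le_def]
  have h2 : (Finset.range (Fintype.card S)).filter (fun k => (i : ℕ) ≤ k) =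
      Finset.Ico (i : ℕ) (Fintype.card S) := by
    ext k
    simp [and_comm]
  rw [Finset.sum_congr rfl fun j _ => h1 j, Fin.sum_univ_eq_sum_range
    (fun k : ℕ => if (i : ℕ) ≤ k then g k - g (k + 1) else 0), ← Finset.sum_filter, h2,
    Finset.sum_Ico_eq_sum_range]
  have h3 := Finset.sum_range_sub' (fun k => g (i + k)) (Fintype.card S - i)
  have hi := i.isLt
  simp only [add_assoc] at *
  rw [h3]
  have h4 : (i : ℕ) + (Fintype.card S - i) = Fintype.card S := by omega
  simp [h4, g]

theorem sum_mul_gap (x π : S → ℤ) (e : Fin (Fintype.card S) ≃ S) :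
    ∑ j, (∑ s ∈ Finset.univ.filter (fun s => e.symm s ≤ j), x s) * gap π e j =
      ∑ s, π s * x s := by
  simp only [Finset.sum_filter, Finset.sum_mul]
  rw [Finset.sum_comm]
  refine Finset.sum_congr rfl fun s _ => ?_
  have := sum_gap_Ici π e (e.symm s)
  rw [Equiv.apply_symm_apply] at this
  rw [← this, Finset.sum_mul]
  refine Finset.sum_congr rfl fun j _ => ?_
  split_ifs <;> ring

theorem filter_le_eq_univ (e : Fin (Fintype.card S) ≃ S) (j : Fin (Fintype.card S))
    (h : ¬ (j : ℕ) + 1 < Fintype.card S) :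
    (Finset.univ.filter fun s => e.symm s ≤ j) = Finset.univ := by
  refine Finset.filter_true_of_mem fun s _ => ?_
  rw [Fin.le_def]
  have := (e.symm s).isLt
  omega

theorem lovaszExt_le (π : S → ℤ) {x : S → ℤ} (hx : IsIntBase p x) :
    lovaszExt p π ≤ ((∑ s, π s * x s : ℤ) : WithBot ℤ) := by
  unfold lovaszExt lovaszAlong
  set e := sortedEnum π with he
  have hanti : Antitone (π ∘ e) := antitone_sortedEnum π
  rw [← sum_mul_gap x π e, WithBot.coe_sum]
  refine Finset.sum_le_sum fun j _ => ?_
  change _ * ((gap π e j : ℤ) : WithBot ℤ) ≤ _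
  by_cases h : (j : ℕ) + 1 < Fintype.card S
  · have hg : 0 ≤ gap π e j := by
      have : π (e ⟨j + 1, h⟩) ≤ π (e j) := hanti (by rw [Fin.le_def]; simp)
      simp only [gap, h, dif_pos]
      omega
    have h1 := hx.le_sum (Finset.univ.filter fun s => e.symm s ≤ j)
    rcases hg.eq_or_lt with h0 | h0
    · simp [← h0]
    · cases hZ : p (Finset.univ.filter fun s => e.symm s ≤ j) with
      | bot => rw [WithBot.bot_mul (by simpa using h0.ne')]; exact bot_le
      | coe a =>
        rw [hZ, WithBot.coe_le_coe] at h1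
        rw [← WithBot.coe_mul, WithBot.coe_le_coe]
        exact mul_le_mul_of_nonneg_right h1 hg
  -- The last coefficient may be negative, so equality on all of `S` is essential here.
  · rw [filter_le_eq_univ e j h, hx.univ_eq, WithBot.coe_mul]

/-- An initial segment with nonzero coefficient, other than `S`, is an upper level set of `π`, so
each term of the Abel summation is an equality. -/
theorem lovaszExt_eq_of_isTight (π : S → ℤ) {x : S → ℤ} (hx : IsIntBase p x)
    (hlev : ∀ c : ℤ, IsTight p x (Finset.univ.filter fun s => c ≤ π s)) :
    lovaszExt p π = ((∑ s, π s * x s : ℤ) : WithBot ℤ) := by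
  unfold lovaszExt lovaszAlong
  set e := sortedEnum π with he
  have hanti : Antitone (π ∘ e) := antitone_sortedEnum π
  rw [← sum_mul_gap x π e, WithBot.coe_sum]
  refine Finset.sum_congr rfl fun j _ => ?_
  change _ * ((gap π e j : ℤ) : WithBot ℤ) = _
  by_cases h : (j : ℕ) + 1 < Fintype.card S
  · by_cases h0 : gap π e j = 0
    · simp [h0]
    · have hlt : π (e ⟨j + 1, h⟩) ≠ π (e j) := by
        simp only [gap, h, dif_pos] at h0
        omega
      have hset : (Finset.univ.filter fun s => e.symm s ≤ j) =
          Finset.univ.filter fun s => π (e j) ≤ π s := by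
        ext s
        simp only [Finset.mem_filter, Finset.mem_univ, true_and]
        constructor
        · intro hs
          simpa using hanti hs
        · intro hs
          by_contra hcon
          have h1 : (⟨j + 1, h⟩ : Fin (Fintype.card S)) ≤ e.symm s := by
            rw [Fin.le_def]
            have := Fin.lt_def.1 (not_le.1 hcon)
            simpa using this
          have h2 := hanti h1
          have h3 : π (e ⟨j + 1, h⟩) ≤ π (e j) := hanti (by rw [Fin.le_def]; simp)
          simp only [Function.comp_apply, Equiv.apply_symm_apply] at h2
          omega
      have := hlev (π (e j))
      rw [← hset] at this
      rw [this, WithBot.coe_mul]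
  · rw [filter_le_eq_univ e j h, hx.univ_eq, WithBot.coe_mul]

end Lovasz

/-! ### Subgradients of discrete convex functions. -/

theorem DiscreteConvex.neg {φ : ℤ → WithTop ℤ} (h : DiscreteConvex φ) :
    DiscreteConvex fun k => φ (-k) := by
  constructor
  · refine ⟨fun a ha b hb c hc => ?_⟩
    exact h.ordConnected_dom.out hb ha ⟨by linarith [hc.2], by linarith [hc.1]⟩
  · intro k hk
    have := h.two_nsmul_le (-k) hk
    rw [add_comm] at this
    convert this using 3 <;> ring_nf

theorem DiscreteConvex.add_nat_mul_le {φ : ℤ → WithTop ℤ} (h : DiscreteConvex φ) {x f π : ℤ}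
    (hf : φ x = (f : WithTop ℤ)) (hπ : ((f + π : ℤ) : WithTop ℤ) ≤ φ (x + 1)) (n : ℕ) :
    ((f + n * π : ℤ) : WithTop ℤ) ≤ φ (x + n) := by
  -- Slopes to the right of `x` never drop below `π`; the interval domain keeps intermediate values
  -- finite.
  have step : ∀ n : ℕ, φ (x + n) + (π : WithTop ℤ) ≤ φ (x + n + 1) := by
    intro n
    induction n with
    | zero => simpa [hf] using hπ
    | succ n ih =>
      by_cases htop : φ (x + (n + 1 : ℕ) + 1) = ⊤
      · rw [htop]; exact le_top
      have hx : φ x ≠ ⊤ := by simp [hf]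
      have h1 : φ (x + (n + 1 : ℕ)) ≠ ⊤ :=
        h.ordConnected_dom.out hx htop ⟨by push_cast; omega, by omega⟩
      have h0 : φ (x + n) ≠ ⊤ :=
        h.ordConnected_dom.out hx htop ⟨by omega, by push_cast; omega⟩
      have hc := h.two_nsmul_le _ h1
      have e1 : x + ((n + 1 : ℕ) : ℤ) - 1 = x + n := by push_cast; ring
      have e2 : x + (n : ℤ) + 1 = x + (n + 1 : ℕ) := by push_cast; ring
      rw [e1] at hc
      rw [e2] at ih
      obtain ⟨a, ha⟩ := WithTop.ne_top_iff_exists.1 h0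
      obtain ⟨b, hb⟩ := WithTop.ne_top_iff_exists.1 h1
      obtain ⟨c, hc'⟩ := WithTop.ne_top_iff_exists.1 htop
      rw [← ha, ← hb] at ih
      rw [← ha, ← hb, ← hc', two_nsmul] at hc
      rw [← hb, ← hc']
      simp only [← WithTop.coe_add, WithTop.coe_le_coe] at *
      omega
  induction n with
  | zero => simp [hf]
  | succ n ih =>
    have h1 := step n
    have e2 : x + ((n + 1 : ℕ) : ℤ) = x + n + 1 := by push_cast; ring
    rw [e2]
    refine le_trans ?_ h1
    refine le_trans ?_ (add_le_add_left ih _)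
    rw [← WithTop.coe_add, WithTop.coe_le_coe]
    push_cast
    linarith

/-- Local subgradients of a discrete convex function are global. -/
theorem DiscreteConvex.add_sub_mul_le {φ : ℤ → WithTop ℤ} (h : DiscreteConvex φ) {x f π : ℤ}
    (hf : φ x = (f : WithTop ℤ)) (hu : ((f + π : ℤ) : WithTop ℤ) ≤ φ (x + 1))
    (hl : ((f - π : ℤ) : WithTop ℤ) ≤ φ (x - 1)) (k : ℤ) :
    ((f + (k - x) * π : ℤ) : WithTop ℤ) ≤ φ k := by
  rcases le_total x k with hk | hk
  · obtain ⟨n, hn⟩ := Int.le.dest hk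
    have := h.add_nat_mul_le hf hu n
    rw [hn] at this
    convert this using 4
    omega
  · obtain ⟨n, hn⟩ := Int.le.dest hk
    have := h.neg.add_nat_mul_le (x := -x) (f := f) (π := -π) (by simpa using hf)
      (by rwa [show -(-x + 1) = x - 1 by ring]) n
    have e : -(-x + (n : ℤ)) = k := by omega
    simp only [e] at this
    convert this using 2
    have : k - x = -n := by omega
    rw [this]
    ring

/-! ### Minimizers and their integral dual certificates. -/

section Core

variable {S : Type*} [Fintype S] {p : Finset S → WithBot ℤ}

/-- A separable function that is feasible and bounded below on the integral bases has a
minimizer. -/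
theorem exists_minimizer {φ : S → ℤ → WithTop ℤ} {x₀ : S → ℤ} (hx₀ : IsIntBase p x₀)
    (hfeas : ∀ s, φ s (x₀ s) ≠ ⊤) {c : ℤ}
    (hc : ∀ y, IsIntBase p y → (c : WithTop ℤ) ≤ ∑ s, φ s (y s)) :
    ∃ x f : S → ℤ, IsIntBase p x ∧ (∀ s, φ s (x s) = (f s : WithTop ℤ)) ∧
      ∀ y, IsIntBase p y → ∑ s, φ s (x s) ≤ ∑ s, φ s (y s) := by
  have hsum : ∑ s, φ s (x₀ s) ≠ ⊤ := by simpa [WithTop.sum_eq_top] using hfeas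
  obtain ⟨m₀, hm₀⟩ := WithTop.ne_top_iff_exists.1 hsum
  obtain ⟨m, ⟨x, hx, hxm⟩, hmin⟩ := Int.exists_least_of_bdd
    (P := fun z => ∃ x, IsIntBase p x ∧ ∑ s, φ s (x s) = (z : WithTop ℤ))
    ⟨c, by
      rintro z ⟨x, hx, h⟩
      have := hc x hx
      rwa [h, WithTop.coe_le_coe] at this⟩
    ⟨m₀, x₀, hx₀, hm₀.symm⟩
  have hfin : ∀ s, φ s (x s) ≠ ⊤ := by
    have : ∑ s, φ s (x s) ≠ ⊤ := by simp [hxm]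
    simpa [WithTop.sum_eq_top] using this
  choose f hf using fun s => WithTop.ne_top_iff_exists.1 (hfin s)
  refine ⟨x, f, hx, fun s => (hf s).symm, fun y hy => ?_⟩
  rw [hxm]
  cases h : ∑ s, φ s (y s) with
  | top => exact le_top
  | coe b => exact WithTop.coe_le_coe.2 (hmin b ⟨y, hy, h⟩)

/-- A monotone selection between bounds that are compatible along a preorder. -/
theorem exists_monotone_between {r : S → S → Prop} (hrefl : ∀ s, r s s)
    (htrans : ∀ a b c, r a b → r b c → r a c) (l : S → ℤ) (P : S → ℤ → Prop)
    (h : ∀ t s, r t s → P s (l t)) :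
    ∃ π : S → ℤ, (∀ s, l s ≤ π s) ∧ (∀ s, P s (π s)) ∧ ∀ t s, r t s → π t ≤ π s := by
  classical
  have hne : ∀ s, (Finset.univ.filter fun t => r t s).Nonempty := fun s => ⟨s, by simp [hrefl]⟩
  refine ⟨fun s => (Finset.univ.filter fun t => r t s).sup' (hne s) l, fun s => ?_, fun s => ?_,
    fun t s hts => ?_⟩
  · exact Finset.le_sup' l (by simp [hrefl])
  · obtain ⟨t, ht, he⟩ := Finset.exists_mem_eq_sup' (hne s) l
    change P s (Finset.sup' _ _ _)
    rw [he]
    exact h t s (by simpa using ht)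
  · refine Finset.sup'_mono l (fun a ha => ?_) (hne t)
    simp only [Finset.mem_filter, Finset.mem_univ, true_and] at *
    exact htrans _ _ _ ha hts

variable [DecidableEq S]

/-- At a minimizer of a separable discrete convex function over the integral bases there is an
integral vector that is a subgradient in each coordinate and whose level sets are tight. -/
theorem exists_dual_of_minimizer (hp : IsSupermodular p) {φ : S → ℤ → WithTop ℤ}
    (hφ : ∀ s, DiscreteConvex (φ s)) {x f : S → ℤ} (hx : IsIntBase p x)
    (hf : ∀ s, φ s (x s) = (f s : WithTop ℤ))
    (hmin : ∀ y, IsIntBase p y → ∑ s, φ s (x s) ≤ ∑ s, φ s (y s)) :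
    ∃ π : S → ℤ, lovaszExt p π = ((∑ s, π s * x s : ℤ) : WithBot ℤ) ∧
      ∀ s k, ((f s + (k - x s) * π s : ℤ) : WithTop ℤ) ≤ φ s k := by
  classical
  let r : S → S → Prop := fun t s => ∀ Z, IsTight p x Z → t ∈ Z → s ∈ Z
  -- `M` lies below all right slopes and replaces a left slope equal to `-∞`.
  obtain ⟨M, hM⟩ : ∃ M : ℤ, ∀ s, ((f s + M : ℤ) : WithTop ℤ) ≤ φ s (x s + 1) := by
    have hM : ∀ s, ∃ M : ℤ, ((f s + M : ℤ) : WithTop ℤ) ≤ φ s (x s + 1) := by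
      intro s
      cases h : φ s (x s + 1) with
      | top => exact ⟨0, le_top⟩
      | coe a => exact ⟨a - f s, by rw [WithTop.coe_le_coe]; omega⟩
    choose m hm using hM
    obtain ⟨M, hM⟩ := (Set.finite_range m).bddBelow
    refine ⟨M, fun s => le_trans (WithTop.coe_le_coe.2 ?_) (hm s)⟩
    have := hM ⟨s, rfl⟩
    omega
  have hex : ∀ s t, r t s → t ≠ s →
      ((f s + f t : ℤ) : WithTop ℤ) ≤ φ s (x s + 1) + φ t (x t - 1) := by
    intro s t hr hne
    have h := hmin _ (hx.exchange (s := s) (t := t) hr)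
    have hst : s ∈ Finset.univ.erase t := by simp [hne.symm]
    rw [← Finset.add_sum_erase _ _ (Finset.mem_univ t), ← Finset.add_sum_erase _ _ hst,
      ← Finset.add_sum_erase Finset.univ _ (Finset.mem_univ t),
      ← Finset.add_sum_erase (Finset.univ.erase t) (fun s => φ s _) hst] at h
    have hrest : ∑ q ∈ (Finset.univ.erase t).erase s,
        φ q ((x + Pi.single s 1 - Pi.single t 1 : S → ℤ) q) =
        ((∑ q ∈ (Finset.univ.erase t).erase s, f q : ℤ) : WithTop ℤ) := by
      rw [WithTop.coe_sum]
      refine Finset.sum_congr rfl fun q hq => ?_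
      simp only [Finset.mem_erase, Finset.mem_univ, and_true] at hq
      simp [hq.1, hq.2, hf]
    have hrest' : ∑ q ∈ (Finset.univ.erase t).erase s, φ q (x q) =
        ((∑ q ∈ (Finset.univ.erase t).erase s, f q : ℤ) : WithTop ℤ) := by
      rw [WithTop.coe_sum]
      exact Finset.sum_congr rfl fun q _ => hf q
    rw [hrest, hrest', hf, hf] at h
    have e1 : (x + Pi.single s 1 - Pi.single t 1 : S → ℤ) t = x t - 1 := by simp [hne]
    have e2 : (x + Pi.single s 1 - Pi.single t 1 : S → ℤ) s = x s + 1 := by simp [hne.symm]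
    rw [e1, e2] at h
    cases h1 : φ s (x s + 1) with
    | top => simp
    | coe a =>
      cases h2 : φ t (x t - 1) with
      | top => simp
      | coe b =>
        rw [h1, h2] at h
        simp only [← WithTop.coe_add, WithTop.coe_le_coe] at *
        omega
  have hloc : ∀ s, ((f s + f s : ℤ) : WithTop ℤ) ≤ φ s (x s + 1) + φ s (x s - 1) := by
    intro s
    have := (hφ s).two_nsmul_le (x s) (by simp [hf])
    rw [hf, two_nsmul, add_comm (φ s _)] at this
    exact_mod_cast this
  have hex' : ∀ s t, r t s →
      ((f s + f t : ℤ) : WithTop ℤ) ≤ φ s (x s + 1) + φ t (x t - 1) := by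
    intro s t hr
    rcases eq_or_ne t s with rfl | hne
    · exact hloc t
    · exact hex s t hr hne
  -- `l` is the left slope at `x t` when finite, and `M` otherwise.
  have hl : ∀ t, ∃ l : ℤ, ((f t - l : ℤ) : WithTop ℤ) ≤ φ t (x t - 1) ∧
      ∀ s, r t s → ((f s + l : ℤ) : WithTop ℤ) ≤ φ s (x s + 1) := by
    intro t
    cases h : φ t (x t - 1) with
    | top => exact ⟨M, le_top, fun s _ => hM s⟩
    | coe a =>
      refine ⟨f t - a, by simp, fun s hs => ?_⟩
      have h1 := hex' s t hs
      rw [h] at h1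
      cases h2 : φ s (x s + 1) with
      | top => exact le_top
      | coe b =>
        rw [h2] at h1
        simp only [← WithTop.coe_add, WithTop.coe_le_coe] at *
        omega
  choose l hl1 hl2 using hl
  obtain ⟨π, hlπ, hπu, hmono⟩ := exists_monotone_between (r := r) (fun s Z _ h => h)
    (fun a b c hab hbc Z hZ h => hbc Z hZ (hab Z hZ h)) l
    (fun s z => ((f s + z : ℤ) : WithTop ℤ) ≤ φ s (x s + 1)) (fun t s h => hl2 t s h)
  refine ⟨π, lovaszExt_eq_of_isTight π hx fun c => ?_, fun s k => ?_⟩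
  · refine isTight_of_closed hp hx _ fun t ht s hts => ?_
    simp only [Finset.mem_filter, Finset.mem_univ, true_and] at *
    exact ht.trans (hmono t s hts)
  · refine (hφ s).add_sub_mul_le (hf s) (hπu s) (le_trans (WithTop.coe_le_coe.2 ?_) (hl1 s)) k
    have := hlπ s
    omega

theorem discreteConvex_linear (a : ℤ) : DiscreteConvex fun k => ((k * a : ℤ) : WithTop ℤ) := by
  constructor
  · exact ⟨fun _ _ _ _ _ _ => WithTop.coe_ne_top⟩
  · intro k _
    rw [two_nsmul, ← WithTop.coe_add, ← WithTop.coe_add, WithTop.coe_le_coe]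
    linarith

/-- The linear extension is at least any lower bound of the linear function on the integral
bases. -/
theorem le_lovaszExt (hp : IsSupermodular p) {π : S → ℤ} {c : ℤ}
    (hc : ∀ y, IsIntBase p y → c ≤ ∑ s, π s * y s) : (c : WithBot ℤ) ≤ lovaszExt p π := by
  obtain ⟨x₀, hx₀⟩ := exists_isIntBase hp
  obtain ⟨x, f, hx, hf, hmin⟩ := exists_minimizer (c := c)
    (φ := fun s k => ((k * π s : ℤ) : WithTop ℤ)) hx₀ (fun _ => WithTop.coe_ne_top) (fun y hy => by
      rw [← WithTop.coe_sum, WithTop.coe_le_coe]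
      simpa [mul_comm] using hc y hy)
  obtain ⟨π', hπ', hsub⟩ := exists_dual_of_minimizer hp (fun s => discreteConvex_linear (π s))
    hx hf hmin
  -- A linear function has a single subgradient; testing at `x s ± 1` pins it down.
  have : π' = π := by
    funext s
    have h1 := hsub s (x s + 1)
    have h2 := hsub s (x s - 1)
    have h3 := hf s
    simp only [WithTop.coe_le_coe, WithTop.coe_inj] at *
    nlinarith
  rw [← this, hπ', this]
  exact WithBot.coe_le_coe.2 (hc x hx)

end Core

/-! ### Distance to an interval of integers. -/

section Distance

/-- The distance of an integer to a set of integers. -/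
noncomputable def intDist (D : Set ℤ) (k : ℤ) : ℕ := sInf ((fun j => (k - j).natAbs) '' D)

theorem intDist_le {D : Set ℤ} {j : ℤ} (hj : j ∈ D) (k : ℤ) : (intDist D k : ℤ) ≤ |k - j| := by
  rw [← Int.natCast_natAbs]
  exact_mod_cast Nat.sInf_le (Set.mem_image_of_mem (fun j => (k - j).natAbs) hj)

theorem exists_intDist_eq {D : Set ℤ} (hD : D.Nonempty) (k : ℤ) :
    ∃ j ∈ D, (intDist D k : ℤ) = |k - j| := by
  obtain ⟨j, hj, h⟩ := Nat.sInf_mem (hD.image fun j => (k - j).natAbs)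
  refine ⟨j, hj, ?_⟩
  rw [← Int.natCast_natAbs]
  exact_mod_cast h.symm

theorem discreteConvex_intDist {D : Set ℤ} (hD : D.Nonempty) (hc : D.OrdConnected) :
    DiscreteConvex fun k => ((intDist D k : ℤ) : WithTop ℤ) := by
  constructor
  · exact ⟨fun _ _ _ _ _ _ => WithTop.coe_ne_top⟩
  · intro k _
    obtain ⟨i, hi, h1⟩ := exists_intDist_eq hD (k - 1)
    obtain ⟨j, hj, h2⟩ := exists_intDist_eq hD (k + 1)
    rw [two_nsmul, ← WithTop.coe_add, ← WithTop.coe_add, WithTop.coe_le_coe, h1, h2]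
    -- The two roundings of the midpoint differ by at most one, so their distances to `k` add up to
    -- `|2k - i - j|`.
    have ha : (i + j) / 2 ∈ D := by
      rcases le_total i j with h | h
      · exact hc.out hi hj ⟨by omega, by omega⟩
      · exact hc.out hj hi ⟨by omega, by omega⟩
    have hb : (i + j + 1) / 2 ∈ D := by
      rcases le_total i j with h | h
      · exact hc.out hi hj ⟨by omega, by omega⟩
      · exact hc.out hj hi ⟨by omega, by omega⟩
    have h3 := intDist_le ha k
    have h4 := intDist_le hb k
    generalize (intDist D k : ℤ) = d at *
    simp only [← Int.natCast_natAbs] at *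
    omega

end Distance

/-! ### Conjugates and values in the extended reals. -/

@[simp] theorem topToEReal_top : topToEReal ⊤ = ⊤ := rfl

@[simp] theorem topToEReal_coe (n : ℤ) : topToEReal (n : WithTop ℤ) = ((n : ℝ) : EReal) := rfl

@[simp] theorem botToEReal_bot : botToEReal ⊥ = ⊥ := rfl

@[simp] theorem botToEReal_coe (n : ℤ) : botToEReal (n : WithBot ℤ) = ((n : ℝ) : EReal) := rfl

theorem botToEReal_mono : Monotone botToEReal := by
  intro a b h
  cases a with
  | bot => simp
  | coe a =>
    cases b with
    | bot => simp at h
    | coe b => simpa using h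

theorem coe_le_intConj {φ : ℤ → WithTop ℤ} {k f : ℤ} (hf : φ k = (f : WithTop ℤ)) (l : ℤ) :
    (((k * l - f : ℤ) : ℝ) : EReal) ≤ intConj φ l := by
  refine le_trans (le_of_eq ?_)
    (le_iSup (fun k : ℤ => (((k * l : ℤ) : ℝ) : EReal) - topToEReal (φ k)) k)
  simp only [hf, topToEReal_coe, ← EReal.coe_sub]
  push_cast
  rfl

theorem intConj_le_coe {φ : ℤ → WithTop ℤ} {l : ℤ} {c : ℝ}
    (h : ∀ k f : ℤ, φ k = (f : WithTop ℤ) → ((k * l - f : ℤ) : ℝ) ≤ c) :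
    intConj φ l ≤ (c : EReal) := by
  refine iSup_le fun k => ?_
  cases hk : φ k with
  | top => simp
  | coe f =>
    have := h k f hk
    rw [topToEReal_coe, ← EReal.coe_sub, EReal.coe_le_coe_iff]
    push_cast at this
    exact_mod_cast this

theorem intConj_eq_bot {φ : ℤ → WithTop ℤ} (h : ∀ k, φ k = ⊤) (l : ℤ) : intConj φ l = ⊥ := by
  simp [intConj, h]

theorem coe_sum_real {ι : Type*} (s : Finset ι) (f : ι → ℝ) :
    ((∑ i ∈ s, f i : ℝ) : EReal) = ∑ i ∈ s, (f i : EReal) := by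
  classical
  induction s using Finset.induction_on with
  | empty => simp
  | insert a s ha ih => rw [Finset.sum_insert ha, Finset.sum_insert ha, EReal.coe_add, ih]

/-! ### Weak duality, strong duality and the infeasible case. -/

section Duality

variable {S : Type*} [Fintype S] {p : Finset S → WithBot ℤ}

theorem weak_duality (φ : S → ℤ → WithTop ℤ) {x : S → ℤ} (hx : IsIntBase p x) (π : S → ℤ) :
    botToEReal (lovaszExt p π) - ∑ s, intConj (φ s) (π s) ≤ topToEReal (∑ s, φ s (x s)) := by
  by_cases htop : ∑ s, φ s (x s) = ⊤
  · simp [htop]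
  have hfin : ∀ s, φ s (x s) ≠ ⊤ := by simpa [WithTop.sum_eq_top] using htop
  choose f hf using fun s => WithTop.ne_top_iff_exists.1 (hfin s)
  have h1 : ((∑ s, ((x s * π s - f s : ℤ) : ℝ) : ℝ) : EReal) ≤ ∑ s, intConj (φ s) (π s) := by
    rw [coe_sum_real]
    exact Finset.sum_le_sum fun s _ => coe_le_intConj (hf s).symm (π s)
  refine (EReal.sub_le_sub (botToEReal_mono (lovaszExt_le π hx)) h1).trans ?_
  rw [Finset.sum_congr rfl fun s _ => (hf s).symm, ← WithTop.coe_sum, topToEReal_coe,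
    botToEReal_coe, ← EReal.coe_sub, EReal.coe_le_coe_iff]
  push_cast
  rw [Finset.sum_sub_distrib]
  simp [mul_comm]

variable [DecidableEq S]

/-- A feasible separable discrete convex problem with a lower bound has an integral primal and an
integral dual solution of the same integer value. -/
theorem exists_strong_duality (hp : IsSupermodular p) {φ : S → ℤ → WithTop ℤ}
    (hφ : ∀ s, DiscreteConvex (φ s)) {x₀ : S → ℤ} (hx₀ : IsIntBase p x₀)
    (hfeas : ∀ s, φ s (x₀ s) ≠ ⊤) {c : ℤ}
    (hc : ∀ y, IsIntBase p y → (c : WithTop ℤ) ≤ ∑ s, φ s (y s)) :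
    ∃ (m : ℤ) (x π : S → ℤ), IsIntBase p x ∧ topToEReal (∑ s, φ s (x s)) = ((m : ℝ) : EReal) ∧
      botToEReal (lovaszExt p π) - ∑ s, intConj (φ s) (π s) = ((m : ℝ) : EReal) := by
  obtain ⟨x, f, hx, hf, hmin⟩ := exists_minimizer hx₀ hfeas hc
  obtain ⟨π, hπ, hsub⟩ := exists_dual_of_minimizer hp hφ hx hf hmin
  have hval : topToEReal (∑ s, φ s (x s)) = (((∑ s, f s : ℤ) : ℝ) : EReal) := by
    rw [Finset.sum_congr rfl fun s _ => hf s, ← WithTop.coe_sum, topToEReal_coe]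
  refine ⟨∑ s, f s, x, π, hx, hval, le_antisymm (hval ▸ weak_duality φ hx π) ?_⟩
  have h1 : ∑ s, intConj (φ s) (π s) ≤ ((∑ s, ((x s * π s - f s : ℤ) : ℝ) : ℝ) : EReal) := by
    rw [coe_sum_real]
    refine Finset.sum_le_sum fun s _ => intConj_le_coe fun k g hg => ?_
    have := hsub s k
    rw [hg, WithTop.coe_le_coe] at this
    exact_mod_cast (by linarith : k * π s - g ≤ x s * π s - f s)
  refine le_trans ?_ (EReal.sub_le_sub le_rfl h1)
  rw [hπ, botToEReal_coe, ← EReal.coe_sub, EReal.coe_le_coe_iff]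
  push_cast
  rw [Finset.sum_sub_distrib]
  simp [mul_comm]

/-- If no integral base lies in the product of the (nonempty) domains, a direction separates
them. -/
theorem exists_separating (hp : IsSupermodular p) {φ : S → ℤ → WithTop ℤ}
    (hφ : ∀ s, DiscreteConvex (φ s)) (hne : ∀ s, ∃ k, φ s k ≠ ⊤)
    (hinf : ∀ x, IsIntBase p x → ∃ s, φ s (x s) = ⊤) :
    ∃ d c : S → ℤ, (∀ s k, φ s k ≠ ⊤ → k * d s ≤ c s) ∧
      ∀ y, IsIntBase p y → ∑ s, c s + 1 ≤ ∑ s, d s * y s := by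
  let D : S → Set ℤ := fun s => {k | φ s k ≠ ⊤}
  obtain ⟨x₀, hx₀⟩ := exists_isIntBase hp
  have hconv : ∀ s, DiscreteConvex fun k => ((intDist (D s) k : ℤ) : WithTop ℤ) := fun s =>
    discreteConvex_intDist (hne s) (hφ s).ordConnected_dom
  obtain ⟨x, f, hx, hf, hmin⟩ := exists_minimizer (c := 0)
    (φ := fun s k => ((intDist (D s) k : ℤ) : WithTop ℤ)) hx₀ (fun _ => WithTop.coe_ne_top) (fun y hy => by
      rw [← WithTop.coe_sum, WithTop.coe_le_coe]
      exact Finset.sum_nonneg fun _ _ => Int.natCast_nonneg _)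
  obtain ⟨d, hd, hsub⟩ := exists_dual_of_minimizer hp hconv hx hf hmin
  have hf' : ∀ s, f s = (intDist (D s) (x s) : ℤ) := fun s => (WithTop.coe_inj.1 (hf s)).symm
  have hpos : 1 ≤ ∑ s, f s := by
    obtain ⟨s, hs⟩ := hinf x hx
    have h1 : f s ≤ ∑ s, f s := Finset.single_le_sum (f := f)
      (fun s _ => by rw [hf']; exact Int.natCast_nonneg _) (Finset.mem_univ s)
    refine le_trans ?_ h1
    obtain ⟨j, hj, h⟩ := exists_intDist_eq (D := D s) (hne s) (x s)
    rw [hf', h]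
    refine Int.one_le_abs fun h0 => hj ?_
    rwa [← sub_eq_zero.1 h0]
  -- On the domain the distance vanishes, so the subgradient inequality bounds `k * d s` by this
  -- constant; the positive minimum `∑ s, f s` supplies the gap of one.
  refine ⟨d, fun s => x s * d s - f s, fun s k hk => ?_, fun y hy => ?_⟩
  · have h1 := hsub s k
    have h2 := intDist_le (D := D s) hk k
    rw [WithTop.coe_le_coe] at h1
    rw [sub_self, abs_zero] at h2
    linarith
  · have h1 := lovaszExt_le d hy
    rw [hd, WithBot.coe_le_coe] at h1
    rw [Finset.sum_sub_distrib]
    simp only [mul_comm (x _)]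
    linarith

/-- A feasible dual problem is unbounded if the primal problem is infeasible. -/
theorem iSup_dual_eq_top (hp : IsSupermodular p) {φ : S → ℤ → WithTop ℤ}
    (hφ : ∀ s, DiscreteConvex (φ s)) (hinf : ∀ x, IsIntBase p x → ∃ s, φ s (x s) = ⊤)
    {π₀ : S → ℤ} (hπ₀ : lovaszExt p π₀ ≠ ⊥) (hψ : ∀ s, intConj (φ s) (π₀ s) ≠ ⊤) :
    (⨆ π : S → ℤ, botToEReal (lovaszExt p π) - ∑ s, intConj (φ s) (π s)) = ⊤ := by
  obtain ⟨a, ha⟩ := WithBot.ne_bot_iff_exists.1 hπ₀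
  by_cases hne : ∀ s, ∃ k, φ s k ≠ ⊤
  · obtain ⟨d, c, hdc, hd⟩ := exists_separating hp hφ hne hinf
    have hψ' : ∀ s, intConj (φ s) (π₀ s) ≠ ⊥ := by
      intro s
      obtain ⟨k, hk⟩ := hne s
      obtain ⟨f, hf⟩ := WithTop.ne_top_iff_exists.1 hk
      exact ((EReal.bot_lt_coe _).trans_le (coe_le_intConj hf.symm (π₀ s))).ne'
    have hg : ∀ s, ∃ r : ℝ, intConj (φ s) (π₀ s) = (r : EReal) := fun s =>
      ⟨_, (EReal.coe_toReal (hψ s) (hψ' s)).symm⟩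
    choose r hr using hg
    have key : ∀ N : ℕ, (((a : ℝ) - ∑ s, r s + N : ℝ) : EReal) ≤
        ⨆ π : S → ℤ, botToEReal (lovaszExt p π) - ∑ s, intConj (φ s) (π s) := by
      intro N
      refine le_trans ?_ (le_iSup _ fun s => π₀ s + N * d s)
      -- Moving by `N * d` raises the linear extension by at least `N * (∑ s, c s + 1)` and the
      -- conjugates by at most `N * ∑ s, c s`: a net gain of at least `N`.
      have h1 : ((a + N * (∑ s, c s + 1) : ℤ) : WithBot ℤ) ≤
          lovaszExt p fun s => π₀ s + N * d s := by
        refine le_lovaszExt hp fun y hy => ?_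
        have h2 := lovaszExt_le π₀ hy
        rw [← ha, WithBot.coe_le_coe] at h2
        have h3 := mul_le_mul_of_nonneg_left (hd y hy) (Int.natCast_nonneg N)
        simp only [add_mul, Finset.sum_add_distrib, mul_assoc, ← Finset.mul_sum]
        linarith
      have h2 : ∑ s, intConj (φ s) (π₀ s + N * d s) ≤
          ((∑ s, (r s + N * c s) : ℝ) : EReal) := by
        rw [coe_sum_real]
        refine Finset.sum_le_sum fun s _ => intConj_le_coe fun k f hf => ?_
        have h3 := coe_le_intConj hf (π₀ s)
        rw [hr, EReal.coe_le_coe_iff] at h3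
        have h4 : ((k * d s : ℤ) : ℝ) ≤ c s := by exact_mod_cast hdc s k (by simp [hf])
        have h5 := mul_le_mul_of_nonneg_left h4 (Nat.cast_nonneg (α := ℝ) N)
        push_cast at *
        linarith
      refine le_trans ?_ (EReal.sub_le_sub (botToEReal_mono h1) h2)
      rw [botToEReal_coe, ← EReal.coe_sub, EReal.coe_le_coe_iff, Finset.sum_add_distrib,
        ← Finset.mul_sum]
      push_cast
      linarith
    refine EReal.eq_top_iff_forall_lt _ |>.2 fun y => ?_
    obtain ⟨N, hN⟩ := exists_nat_gt (y - ((a : ℝ) - ∑ s, r s))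
    refine lt_of_lt_of_le (EReal.coe_lt_coe_iff.2 ?_) (key N)
    linarith
  · push Not at hne
    -- Here `φ s` is identically `⊤`, so its conjugate is `⊥` and the dual value at `π₀` is already
    -- `⊤`.
    obtain ⟨s, hs⟩ := hne
    refine top_le_iff.1 (le_trans (le_of_eq ?_) (le_iSup _ π₀))
    rw [← Finset.add_sum_erase _ _ (Finset.mem_univ s), intConj_eq_bot hs, EReal.bot_add, ← ha]
    simp

end Duality

end SepConvex

/-! ### The min-max theorem. -/

theorem mainTheorem5 {S : Type*} [Fintype S] [DecidableEq S] [Nonempty S]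
    (p : Finset S → WithBot ℤ) (hp : SepConvex.IsSupermodular p)
    (φ : S → ℤ → WithTop ℤ) (hφ : ∀ s, SepConvex.DiscreteConvex (φ s))
    (hfeas :
      (∃ x ∈ SepConvex.integerPoints (SepConvex.basePolyhedron p), ∀ s, φ s (x s) < ⊤) ∨
      (∃ π : S → ℤ, ⊥ < SepConvex.lovaszExt p π ∧ ∀ s, SepConvex.intConj (φ s) (π s) < ⊤)) :
    (⨅ x ∈ SepConvex.integerPoints (SepConvex.basePolyhedron p),
        SepConvex.topToEReal (∑ s, φ s (x s))) =
      (⨆ π : S → ℤ, SepConvex.botToEReal (SepConvex.lovaszExt p π)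
        - ∑ s, SepConvex.intConj (φ s) (π s)) ∧
    ((⨅ x ∈ SepConvex.integerPoints (SepConvex.basePolyhedron p),
        SepConvex.topToEReal (∑ s, φ s (x s))) ≠ ⊥ →
     (⨅ x ∈ SepConvex.integerPoints (SepConvex.basePolyhedron p),
        SepConvex.topToEReal (∑ s, φ s (x s))) ≠ ⊤ →
      ∃ m : ℤ,
        IsLeast ((fun x : S → ℤ => SepConvex.topToEReal (∑ s, φ s (x s))) ''
          SepConvex.integerPoints (SepConvex.basePolyhedron p)) ((m : ℝ) : EReal) ∧
        IsGreatest (Set.range fun π : S → ℤ =>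
          SepConvex.botToEReal (SepConvex.lovaszExt p π)
            - ∑ s, SepConvex.intConj (φ s) (π s)) ((m : ℝ) : EReal)) := by
  simp only [SepConvex.mem_integerPoints_iff] at hfeas
  have hset : SepConvex.integerPoints (SepConvex.basePolyhedron p) =
      {x | SepConvex.IsIntBase p x} := Set.ext SepConvex.mem_integerPoints_iff
  rw [hset]
  by_cases hprim : ∃ x, SepConvex.IsIntBase p x ∧ ∀ s, φ s (x s) < ⊤
  · obtain ⟨x₀, hx₀, hfin⟩ := hprim
    have hweak : (⨆ π : S → ℤ, SepConvex.botToEReal (SepConvex.lovaszExt p π)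
        - ∑ s, SepConvex.intConj (φ s) (π s)) ≤ ⨅ x ∈ {x | SepConvex.IsIntBase p x},
          SepConvex.topToEReal (∑ s, φ s (x s)) :=
      iSup_le fun π => le_iInf₂ fun x hx => SepConvex.weak_duality φ hx π
    by_cases hbot : (⨅ x ∈ {x | SepConvex.IsIntBase p x},
        SepConvex.topToEReal (∑ s, φ s (x s))) = ⊥
    · refine ⟨?_, fun h => absurd hbot h⟩
      rw [hbot] at hweak ⊢
      exact (le_bot_iff.1 hweak).symm
    · obtain ⟨c, hc⟩ : ∃ c : ℤ, ∀ y, SepConvex.IsIntBase p y →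
          (c : WithTop ℤ) ≤ ∑ s, φ s (y s) := by
        obtain ⟨r, hr⟩ := EReal.lt_iff_exists_real_btwn.1 (bot_lt_iff_ne_bot.2 hbot)
        refine ⟨⌊r⌋, fun y hy => ?_⟩
        have h1 := hr.2.le.trans (iInf₂_le y hy)
        cases hs : ∑ s, φ s (y s) with
        | top => exact le_top
        | coe b =>
          rw [hs, SepConvex.topToEReal_coe, EReal.coe_le_coe_iff] at h1
          exact WithTop.coe_le_coe.2 (by exact_mod_cast (Int.floor_le r).trans h1)
      obtain ⟨m, x, π, hx, hxm, hπm⟩ :=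
        SepConvex.exists_strong_duality hp hφ hx₀ (fun s => (hfin s).ne) hc
      have hle : ((m : ℝ) : EReal) ≤ ⨆ π : S → ℤ, SepConvex.botToEReal (SepConvex.lovaszExt p π)
          - ∑ s, SepConvex.intConj (φ s) (π s) := hπm ▸ le_iSup (fun π : S → ℤ =>
            SepConvex.botToEReal (SepConvex.lovaszExt p π)
              - ∑ s, SepConvex.intConj (φ s) (π s)) π
      refine ⟨le_antisymm ((iInf₂_le x hx).trans (hxm.le.trans hle)) hweak, fun _ _ =>
        ⟨m, ⟨⟨x, hx, hxm⟩, ?_⟩, ⟨⟨π, hπm⟩, ?_⟩⟩⟩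
      · rintro _ ⟨y, hy, rfl⟩
        exact hπm ▸ SepConvex.weak_duality φ hy π
      · rintro _ ⟨π', rfl⟩
        exact hxm ▸ SepConvex.weak_duality φ hx π'
  · have hinf : ∀ x, SepConvex.IsIntBase p x → ∃ s, φ s (x s) = ⊤ := by
      intro x hx
      by_contra! h
      exact hprim ⟨x, hx, fun s => lt_top_iff_ne_top.2 (h s)⟩
    obtain ⟨π₀, hπ₀, hψ⟩ := hfeas.resolve_left hprim
    have htop : (⨅ x ∈ {x | SepConvex.IsIntBase p x},
        SepConvex.topToEReal (∑ s, φ s (x s))) = ⊤ := by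
      simp only [iInf_eq_top]
      intro x hx
      rw [WithTop.sum_eq_top.2 (by simpa using hinf x hx), SepConvex.topToEReal_top]
    refine ⟨?_, fun _ h => absurd htop h⟩
    rw [htop, SepConvex.iSup_dual_eq_top hp hφ hinf hπ₀.ne' fun s => (hψ s).ne]
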